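/- We work over $\mathbb{C}$. Let $X\subseteq\mathbb{P}^N$ be an irreducible projective variety and let $r\ge 1$. Let $\sigma_r(X)$ be the $r$-th secant variety of $X$, that is, the Zariski closure of the set of points $p\in\mathbb{P}^N$ that lie in the span $\langle z_1,\dots,z_r\rangle$ of some $z_1,\dots,z_r\in X$. Suppose that $\sigma_r(X)$ is a hypersurface, i.e. $\dim\sigma_r(X)=N-1$. Its homogeneous ideal is then principal; let $f$ be a generator, and put $\deg\sigma_r(X)=\deg f$ and, for $p\in\mathbb{P}^N$, $\operatorname{mult}_{\sigma_r(X)}(p)=\max\{k : f\in\mathfrak{m}_p^k\}$, where $\mathfrak{m}_p$ is the homogeneous ideal of the point $p$. Let $z\in X$ satisfy $$\operatorname{mult}_{\sigma_r(X)}(z)\le \deg\sigma_r(X)-2 .$$ Then a generic line $L$ through $z$ is a secant with a double drop for $\sigma_{r+1}(X)$. That is, for every $L$ in a nonempty Zariski open subset of the space $\cong\mathbb{P}^{N-1}$ of lines through $z$: 1. $z\in L\cap X$; 2. there are distinct points $q_0,q_1\in L\cap\sigma_r(X)$, both different from $z$; 3. $L\not\subseteq\sigma_r(X)$. -/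

import Mathlib

open scoped LinearAlgebra.Projectivization

namespace SecantDrop

/-- The projective space of lines in `ℂ ^ (N + 1)`. -/
abbrev PN (N : ℕ) : Type := ℙ ℂ (Fin (N + 1) → ℂ)

/-- The homogeneous coordinate ring of `PN N`. -/
abbrev Coord (N : ℕ) : Type := MvPolynomial (Fin (N + 1)) ℂ

/-- The set of common zeros in projective space of a family of polynomials, evaluated at chosen
representatives; it is only used for families of homogeneous polynomials, where the choice does
not matter (see `eval_rep_eq_zero_iff`). -/
def projZeros {N : ℕ} (F : Set (Coord N)) : Set (PN N) :=
  {p | ∀ f ∈ F, MvPolynomial.eval p.rep f = 0}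

theorem eval_rep_eq_zero_iff {N : ℕ} {f : Coord N} {d : ℕ} (hf : f.IsHomogeneous d)
    (v : Fin (N + 1) → ℂ) (hv : v ≠ 0) :
    MvPolynomial.eval (Projectivization.mk ℂ v hv).rep f = 0 ↔ MvPolynomial.eval v f = 0 := by
  obtain ⟨a, ha⟩ := Projectivization.exists_smul_eq_mk_rep ℂ v hv
  have h : MvPolynomial.eval ((a : ℂ) • v) f = (a : ℂ) ^ d * MvPolynomial.eval v f := by
    rw [MvPolynomial.eval_eq, MvPolynomial.eval_eq, Finset.mul_sum]
    refine Finset.sum_congr rfl fun m hm => ?_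
    have hd : ∑ i ∈ m.support, m i = d := by
      have := hf (MvPolynomial.mem_support_iff.mp hm)
      simpa [Finsupp.weight_apply, Finsupp.sum] using this
    simp only [Pi.smul_apply, smul_eq_mul, mul_pow, Finset.prod_mul_distrib,
      Finset.prod_pow_eq_pow_sum, hd]
    ring
  rw [← ha, Units.smul_def, h]
  simp

/-- A subset of projective space is Zariski closed if it is the zero set of a family of
homogeneous polynomials. -/
def IsZariskiClosed {N : ℕ} (Z : Set (PN N)) : Prop :=
  ∃ F : Set (Coord N), (∀ f ∈ F, ∃ d : ℕ, f.IsHomogeneous d) ∧ Z = projZeros F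

/-- The Zariski topology on projective space. -/
instance zariskiTopology (N : ℕ) : TopologicalSpace (PN N) :=
  TopologicalSpace.ofClosed {Z | IsZariskiClosed Z}
    ⟨{1}, by simpa using ⟨0, MvPolynomial.isHomogeneous_one _ _⟩, by simp [projZeros]⟩
    (by
      intro A hA
      have hA' : ∀ Z ∈ A, ∃ F : Set (Coord N),
          (∀ f ∈ F, ∃ d : ℕ, f.IsHomogeneous d) ∧ Z = projZeros F := fun Z hZ => hA hZ
      choose! F hF using hA'
      refine ⟨⋃ Z ∈ A, F Z, ?_, ?_⟩
      · intro f hf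
        simp only [Set.mem_iUnion] at hf
        obtain ⟨Z, hZ, hf⟩ := hf
        exact (hF Z hZ).1 f hf
      · ext p
        simp only [Set.mem_sInter, projZeros, Set.mem_iUnion, Set.mem_ofPred_eq]
        constructor
        · rintro h f ⟨Z, hZ, hf⟩
          have := h Z hZ
          rw [(hF Z hZ).2] at this
          exact this f hf
        · intro h Z hZ
          rw [(hF Z hZ).2]
          exact fun f hf => h f ⟨Z, hZ, hf⟩)
    (by
      rintro _ ⟨F, hF, rfl⟩ _ ⟨G, hG, rfl⟩
      refine ⟨{h | ∃ f ∈ F, ∃ g ∈ G, h = f * g}, ?_, ?_⟩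
      · rintro _ ⟨f, hf, g, hg, rfl⟩
        obtain ⟨a, ha⟩ := hF f hf
        obtain ⟨b, hb⟩ := hG g hg
        exact ⟨a + b, ha.mul hb⟩
      · ext p
        simp only [projZeros, Set.mem_union, Set.mem_ofPred_eq]
        constructor
        · rintro (h | h) _ ⟨f, hf, g, hg, rfl⟩
          · simp [h f hf]
          · simp [h g hg]
        · intro h
          by_contra! hcon
          obtain ⟨⟨f, hf, hf0⟩, ⟨g, hg, hg0⟩⟩ := hcon
          have := h _ ⟨f, hf, g, hg, rfl⟩
          rw [map_mul] at this
          exact (mul_ne_zero hf0 hg0) this)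

theorem isClosed_iff {N : ℕ} (Z : Set (PN N)) : IsClosed Z ↔ IsZariskiClosed Z := by
  rw [← isOpen_compl_iff]
  change IsZariskiClosed Zᶜᶜ ↔ _
  rw [compl_compl]

/-- A (projective) irreducible variety: an irreducible, in particular nonempty, Zariski closed
subset of projective space. -/
def IsIrreducibleVariety {N : ℕ} (X : Set (PN N)) : Prop :=
  IsClosed X ∧ IsIrreducible X

/-- The affine cone over a subset of projective space. -/
def affineCone {N : ℕ} (S : Set (PN N)) : Set (Fin (N + 1) → ℂ) :=
  {v | ∃ p ∈ S, v ∈ p.submodule}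

/-- The homogeneous ideal `I(S)` of a nonempty subset of projective space: all polynomials
vanishing on the affine cone. -/
noncomputable def homogIdeal {N : ℕ} (S : Set (PN N)) : Ideal (Coord N) :=
  MvPolynomial.vanishingIdeal ℂ (affineCone S)

/-- The points of `X`-rank at most `r`: those in the span of `r` points of `X`
(repetitions allowed). -/
def rankAtMost {N : ℕ} (X : Set (PN N)) (r : ℕ) : Set (PN N) :=
  {p | ∃ z : Fin r → PN N, (∀ i, z i ∈ X) ∧ p.submodule ≤ ⨆ i, (z i).submodule}

/-- The `r`-th secant variety of `X`: the Zariski closure of the set of points of `X`-rank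
at most `r`. -/
def secantVariety {N : ℕ} (X : Set (PN N)) (r : ℕ) : Set (PN N) :=
  closure (rankAtMost X r)

/-- A hypersurface: a closed subset of dimension `N - 1`, the dimension being the Krull dimension
in the Zariski topology. -/
def IsHypersurface {N : ℕ} (S : Set (PN N)) : Prop :=
  IsClosed S ∧ topologicalKrullDim S + 1 = (N : WithBot ℕ∞)

/-- `f` is an equation of `S`: a generator of the homogeneous ideal of `S`. -/
def IsEquation {N : ℕ} (S : Set (PN N)) (f : Coord N) : Prop :=
  homogIdeal S = Ideal.span {f}

/-- The degree of a hypersurface: the degree of a generator of its ideal (all generators have the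
same degree). -/
noncomputable def hypersurfaceDegree {N : ℕ} (S : Set (PN N)) : ℕ :=
  sInf {d | ∃ f, IsEquation S f ∧ f.totalDegree = d}

/-- The multiplicity of a point `p` in a hypersurface `S`: the largest `k` such that the equation
of `S` lies in the `k`-th power of the homogeneous ideal of the point `p`. -/
noncomputable def hypersurfaceMult {N : ℕ} (S : Set (PN N)) (p : PN N) : ℕ :=
  sSup {k | ∃ f, IsEquation S f ∧ f ∈ homogIdeal {p} ^ k}

/-- A line in projective space, as a set of points. -/
def IsLine {N : ℕ} (L : Set (PN N)) : Prop :=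
  ∃ W : Submodule ℂ (Fin (N + 1) → ℂ), Module.finrank ℂ W = 2 ∧ L = {p | p.submodule ≤ W}

/-- The span of two points; a line if they are distinct. -/
def lineThrough {N : ℕ} (z q : PN N) : Set (PN N) :=
  {p | p.submodule ≤ z.submodule ⊔ q.submodule}

/-- A property `P` holds for a generic line through `z`: it holds on a nonempty Zariski open
subset `U` of the space of lines through `z`. That space, a projective space of dimension `N - 1`,
carries the quotient topology along `q ↦ lineThrough z q`, `q ≠ z` (the projection from `z`). -/
def GenericLineThrough {N : ℕ} (z : PN N) (P : Set (PN N) → Prop) : Prop :=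
  ∃ U : Set (Set (PN N)), (∀ L ∈ U, IsLine L ∧ z ∈ L) ∧ U.Nonempty ∧
    IsOpen {q : PN N | q ≠ z ∧ lineThrough z q ∈ U} ∧ ∀ L ∈ U, P L

/-- `L` is a secant with a double drop for the `(r + 1)`-st secant variety of `X`, with base
point `z`: it is a line through the point `z` of `X`, it meets the `r`-th secant variety in two
distinct points different from `z`, and it is not contained in the `r`-th secant variety. -/
structure IsDoubleDropSecant {N : ℕ} (X : Set (PN N)) (r : ℕ) (z : PN N) (L : Set (PN N)) :
    Prop where
  isLine : IsLine L
  base_mem : z ∈ L ∩ X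
  two_points : ∃ q₀ ∈ L ∩ secantVariety X r, ∃ q₁ ∈ L ∩ secantVariety X r,
    q₀ ≠ q₁ ∧ q₀ ≠ z ∧ q₁ ≠ z
  not_subset : ¬ L ⊆ secantVariety X r

end SecantDrop

/-! Let `f`, of degree `d`, generate the ideal of the secant variety `S`. The points other than `z`
on the line joining `z` to `[v]` are the `[v + s z]`, so everything is read off from `F(s) = f(y + s
z)`, a polynomial in `s` over `ℂ[y]` (`lineFamily`), of degree `e` say.

If `e ≤ 1`, expanding `f` along `z` puts it in the `(d - 1)`-st power of the ideal of `z`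
(`mem_pow_of_natDegree_lineFamily_le_one`). The bound on the multiplicity therefore forces `e ≥ 2`.

Since `I(S)` is radical, `f` is squarefree, and hence so is `F` (`squarefree_lineFamily`). A
squarefree `F` of degree at least 2 is not a constant times a power of a linear polynomial, so
`rootTest` is nonzero on it (`rootTest_ne_zero`). Where the leading coefficient of `F` and some
coefficient of its root test do not vanish at `v`, the polynomial `f(v + s z)` has degree `e` and
two distinct roots. The roots give the two points, and the restriction being nonzero keeps the line
out of `S`. -/

namespace SecantDrop

open MvPolynomial

/-! ### Homogeneous polynomials and powers of ideals -/

section Homogeneity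

variable {σ : Type*}

theorem eval_smul_of_isHomogeneous {f : MvPolynomial σ ℂ} {d : ℕ} (hf : f.IsHomogeneous d)
    (a : ℂ) (v : σ → ℂ) : eval (a • v) f = a ^ d * eval v f := by
  rw [eval_eq, eval_eq, Finset.mul_sum]
  refine Finset.sum_congr rfl fun m hm => ?_
  have hd : ∑ i ∈ m.support, m i = d := by
    have := hf (mem_support_iff.mp hm)
    simpa [Finsupp.weight_apply, Finsupp.sum] using this
  simp only [Pi.smul_apply, smul_eq_mul, mul_pow, Finset.prod_mul_distrib,
    Finset.prod_pow_eq_pow_sum, hd]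
  ring

/-- If a polynomial vanishes on a punctured line through the origin, so do its components. -/
theorem eval_homogeneousComponent_eq_zero {g : MvPolynomial σ ℂ} {v : σ → ℂ}
    (h : ∀ a : ℂ, a ≠ 0 → eval (a • v) g = 0) (k : ℕ) :
    eval v (homogeneousComponent k g) = 0 := by
  -- `P(a) = g(a v)`, and the coefficients of `P` are the values to be killed.
  set P : Polynomial ℂ := ∑ k ∈ Finset.range (g.totalDegree + 1),
    Polynomial.monomial k (eval v (homogeneousComponent k g)) with hP
  have hscale : ∀ a : ℂ, P.eval a = eval (a • v) g := by
    intro a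
    conv_rhs => rw [← sum_homogeneousComponent g]
    rw [hP, Polynomial.eval_finsetSum, map_sum]
    refine Finset.sum_congr rfl fun k _ => ?_
    rw [Polynomial.eval_monomial, mul_comm,
      eval_smul_of_isHomogeneous (homogeneousComponent_isHomogeneous k g)]
  have hP0 : P = 0 := by
    refine Polynomial.eq_zero_of_infinite_isRoot P ?_
    refine Set.Infinite.mono (s := {0}ᶜ) (fun a ha => ?_) (Set.finite_singleton 0).infinite_compl
    exact (hscale a).trans (h a ha)
  by_cases hk : k < g.totalDegree + 1
  · have := congrArg (fun Q => Polynomial.coeff Q k) hP0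
    simpa [hP, Polynomial.finsetSum_coeff, Polynomial.coeff_monomial, hk] using this
  · rw [homogeneousComponent_eq_zero _ _ (by omega), map_zero]

theorem aeval_mem_pow_of_isHomogeneous {τ : Type*} {g : MvPolynomial σ ℂ} {k : ℕ}
    (hg : g.IsHomogeneous k) {I : Ideal (MvPolynomial τ ℂ)} {h : σ → MvPolynomial τ ℂ}
    (hI : ∀ i, h i ∈ I) : aeval h g ∈ I ^ k := by
  have hmem : g ∈ idealOfVars σ ℂ ^ k := by
    rw [mem_pow_idealOfVars_iff]
    intro x hx
    have := hg (mem_support_iff.mp hx)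
    rw [Finsupp.degree_eq_weight_one]
    exact this.ge
  have hle : (idealOfVars σ ℂ).map (aeval h) ≤ I := by
    rw [idealOfVars, Ideal.map_span, Ideal.span_le]
    rintro _ ⟨_, ⟨i, rfl⟩, rfl⟩
    simpa using hI i
  have := Ideal.mem_map_of_mem (aeval h) hmem
  rw [Ideal.map_pow] at this
  exact Ideal.pow_right_mono hle k this

/-- Bounds the exponents in the definition of the multiplicity, so that its `sSup` is a genuine
supremum. -/
theorem le_totalDegree_of_mem_pow {f : MvPolynomial σ ℂ} (hf : f ≠ 0) {k : ℕ}
    {I : Ideal (MvPolynomial σ ℂ)} (hI : ∀ g ∈ I, eval 0 g = 0) (h : f ∈ I ^ k) :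
    k ≤ f.totalDegree := by
  have hle : I ≤ idealOfVars σ ℂ := by
    intro g hg
    rw [← pow_one (idealOfVars σ ℂ), mem_pow_idealOfVars_iff']
    intro x hx
    obtain rfl : x = 0 := (Finsupp.degree_eq_zero_iff x).mp (by omega)
    have := hI g hg
    rwa [← constantCoeff_eq, eval_zero] at * 
  obtain ⟨x, hx⟩ := support_nonempty.mpr hf
  have h1 := (mem_pow_idealOfVars_iff k f).mp (Ideal.pow_right_mono hle k h) x hx
  exact h1.trans (le_totalDegree hx)

end Homogeneity

/-! ### Restriction of a polynomial to the lines in direction `z` -/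

section Family

variable {n : ℕ}

/-- The substitution `y ↦ y + s z`, `s ↦ s`, the variable `s` being the first one. -/
noncomputable def shiftHom (z : Fin n → ℂ) :
    MvPolynomial (Fin (n + 1)) ℂ →ₐ[ℂ] MvPolynomial (Fin (n + 1)) ℂ :=
  aeval (Fin.cases (X 0) fun i => X i.succ + C (z i) * X 0)

theorem shiftHom_X_zero (z : Fin n → ℂ) : shiftHom z (X 0) = X 0 := by
  simp [shiftHom]

theorem shiftHom_X_succ (z : Fin n → ℂ) (i : Fin n) :
    shiftHom z (X i.succ) = X i.succ + C (z i) * X 0 := by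
  simp [shiftHom]

theorem shiftHom_comp_neg (z : Fin n → ℂ) :
    (shiftHom z).comp (shiftHom (-z)) = AlgHom.id ℂ _ := by
  refine MvPolynomial.algHom_ext fun i => ?_
  refine Fin.cases ?_ (fun i => ?_) i
  · simp [shiftHom_X_zero]
  · simp [shiftHom_X_zero, shiftHom_X_succ]

/-- The substitution `y ↦ y + s z`, `s ↦ s` as an automorphism. -/
noncomputable def shiftEquiv (z : Fin n → ℂ) :
    MvPolynomial (Fin (n + 1)) ℂ ≃ₐ[ℂ] MvPolynomial (Fin (n + 1)) ℂ :=
  AlgEquiv.ofAlgHom (shiftHom z) (shiftHom (-z)) (shiftHom_comp_neg z)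
    (by simpa using shiftHom_comp_neg (-z))

/-- The polynomial `f (y + s z)` in the variable `s`, with coefficients polynomials in `y`. -/
noncomputable def lineFamily (z : Fin n → ℂ) (f : MvPolynomial (Fin n) ℂ) :
    Polynomial (MvPolynomial (Fin n) ℂ) :=
  finSuccEquiv ℂ n (shiftEquiv z (rename Fin.succ f))

theorem finSuccEquiv_rename_succ (f : MvPolynomial (Fin n) ℂ) :
    finSuccEquiv ℂ n (rename Fin.succ f) = Polynomial.C f := by
  induction f using MvPolynomial.induction_on with
  | C a => simp [finSuccEquiv_apply]
  | add p q hp hq => simp [hp, hq]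
  | mul_X p i hp => simp [hp, finSuccEquiv_X_succ]

theorem squarefree_map_mulEquiv {A B : Type*} [CommMonoid A] [CommMonoid B] (e : A ≃* B) {a : A}
    (ha : Squarefree a) : Squarefree (e a) := by
  rintro x ⟨y, hy⟩
  have : e.symm x * e.symm x ∣ a := ⟨e.symm y, by rw [← map_mul, ← map_mul, ← hy]; simp⟩
  simpa using (ha _ this).map e

theorem squarefree_polynomial_C {A : Type*} [CommRing A] [IsDomain A] {a : A} (h0 : a ≠ 0)
    (ha : Squarefree a) : Squarefree (Polynomial.C a) := by
  intro p hp
  have hdeg : p.natDegree = 0 := by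
    have := Polynomial.natDegree_le_of_dvd hp (by simpa using h0)
    have hp0 : p ≠ 0 := by
      rintro rfl
      exact h0 (by simpa using hp)
    rw [Polynomial.natDegree_mul hp0 hp0, Polynomial.natDegree_C] at this
    omega
  rw [Polynomial.eq_C_of_natDegree_eq_zero hdeg, ← Polynomial.C_mul,
    Polynomial.C_dvd_iff_dvd_coeff] at hp
  rw [Polynomial.eq_C_of_natDegree_eq_zero hdeg]
  exact (ha _ (by simpa using hp 0)).map Polynomial.C

/-- Ring isomorphisms carry the constant polynomial `f` to the family, and they preserve
squarefreeness. -/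
theorem squarefree_lineFamily (z : Fin n → ℂ) {f : MvPolynomial (Fin n) ℂ} (h0 : f ≠ 0)
    (hf : Squarefree f) : Squarefree (lineFamily z f) := by
  have h1 := squarefree_polynomial_C h0 hf
  rw [← finSuccEquiv_rename_succ] at h1
  have h2 := squarefree_map_mulEquiv (finSuccEquiv ℂ n).symm.toMulEquiv h1
  have h3 := squarefree_map_mulEquiv (shiftEquiv z).toMulEquiv h2
  have h4 := squarefree_map_mulEquiv (finSuccEquiv ℂ n).toMulEquiv h3
  simpa [lineFamily] using h4

theorem lineFamily_ne_zero (z : Fin n → ℂ) {f : MvPolynomial (Fin n) ℂ} (h0 : f ≠ 0) :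
    lineFamily z f ≠ 0 := by
  simpa [lineFamily, rename_eq_zero_iff_of_injective _ (Fin.succ_injective n)] using h0

theorem isHomogeneous_coeff_lineFamily (z : Fin n → ℂ) {f : MvPolynomial (Fin n) ℂ} {d : ℕ}
    (hf : f.IsHomogeneous d) {i j : ℕ} (hij : i + j = d) :
    ((lineFamily z f).coeff i).IsHomogeneous j := by
  refine IsHomogeneous.finSuccEquiv_coeff_isHomogeneous ?_ i j hij
  have := hf.rename_isHomogeneous (f := Fin.succ)
  have h2 := this.aeval (n := 1)
    (Fin.cases (X 0) fun i => X i.succ + C (z i) * X 0 : Fin (n + 1) → MvPolynomial _ ℂ) ?_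
  · rwa [one_mul] at h2
  · intro i
    refine Fin.cases (isHomogeneous_X _ _) (fun i => ?_) i
    exact (isHomogeneous_X _ _).add (isHomogeneous_C_mul_X _ _)

/-- The restriction `s ↦ f (v + s z)` of `f` to a line. -/
noncomputable def lineRestriction (z : Fin n → ℂ) (f : MvPolynomial (Fin n) ℂ) (v : Fin n → ℂ) :
    Polynomial ℂ :=
  (lineFamily z f).map (eval v)

/-- A general algebra `A` serves two uses: `A = ℂ` for values on a line, and `A = ℂ[y]` with `s` a
polynomial for the expansion of `f` along `z`. -/
theorem aeval_lineFamily {A : Type*} [CommRing A] [Algebra ℂ A] (z : Fin n → ℂ)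
    (f : MvPolynomial (Fin n) ℂ) (y : Fin n → A) (s : A) :
    (lineFamily z f).eval₂ (aeval y : _ →ₐ[ℂ] A).toRingHom s =
      aeval (fun i => y i + algebraMap ℂ A (z i) * s) f := by
  induction f using MvPolynomial.induction_on with
  | C a => simp [lineFamily, shiftEquiv, finSuccEquiv_apply]
  | add p q hp hq => simp_all [lineFamily, Polynomial.eval₂_add]
  | mul_X p i hp =>
    have : lineFamily z (p * X i) = lineFamily z p *
        (Polynomial.C (X i) + Polynomial.C (C (z i)) * Polynomial.X) := by
      simp [lineFamily, shiftEquiv, shiftHom_X_succ, finSuccEquiv_X_succ, finSuccEquiv_X_zero]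
      left
      simp [finSuccEquiv_apply]
    rw [this, Polynomial.eval₂_mul, hp, map_mul, aeval_X]
    simp

theorem eval_lineRestriction (z : Fin n → ℂ) (f : MvPolynomial (Fin n) ℂ) (v : Fin n → ℂ)
    (s : ℂ) : (lineRestriction z f v).eval s = eval (v + s • z) f := by
  have := aeval_lineFamily z f v s
  rw [lineRestriction, Polynomial.eval_map]
  have harg : v + s • z = fun i => v i + algebraMap ℂ ℂ (z i) * s := by
    ext i
    simp [mul_comm]
  rw [harg, ← MvPolynomial.coe_aeval_eq_eval, ← MvPolynomial.coe_aeval_eq_eval]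
  exact this

end Family

/-! ### Detecting two distinct roots by polynomial conditions on the coefficients -/

section RootTest

/-- For a polynomial `F = a X ^ e + b X ^ (e - 1) + ⋯` the difference
`e ^ e * a ^ (e - 1) * F - (e a X + b) ^ e`, which vanishes iff `F` has only one root. -/
noncomputable def rootTest {R : Type*} [CommRing R] (e : ℕ) (F : Polynomial R) : Polynomial R :=
  Polynomial.C ((e : R) ^ e * F.coeff e ^ (e - 1)) * F -
    (Polynomial.C ((e : R) * F.coeff e) * Polynomial.X + Polynomial.C (F.coeff (e - 1))) ^ e

theorem map_rootTest {R S : Type*} [CommRing R] [CommRing S] (φ : R →+* S) (e : ℕ)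
    (F : Polynomial R) : (rootTest e F).map φ = rootTest e (F.map φ) := by
  simp [rootTest]

theorem exists_prime_dvd_of_natDegree_ne_zero {R : Type*} [CommRing R] [IsDomain R]
    [UniqueFactorizationMonoid R] (G : Polynomial R) :
    G.natDegree ≠ 0 → ∃ p, Prime p ∧ p ∣ G ∧ p.natDegree ≠ 0 := by
  induction G using UniqueFactorizationMonoid.induction_on_prime with
  | h₁ => simp
  | h₂ x hx => exact fun h => absurd (Polynomial.natDegree_eq_zero_of_isUnit hx) h
  | h₃ a p ha hp ih =>
    intro h
    by_cases hpd : p.natDegree = 0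
    · rw [Polynomial.natDegree_mul hp.ne_zero ha, hpd, zero_add] at h
      obtain ⟨q, hq, hqa, hqd⟩ := ih h
      exact ⟨q, hq, hqa.mul_left _, hqd⟩
    · exact ⟨p, hp, dvd_mul_right _ _, hpd⟩

/-- Otherwise a nonzero constant times `F` is the `e`-th power of a linear polynomial. A prime
factor of positive degree of the latter does not divide the constant, so its `e`-th power divides
`F`, against squarefreeness as `e ≥ 2`. -/
theorem rootTest_ne_zero {R : Type*} [CommRing R] [IsDomain R] [UniqueFactorizationMonoid R]
    [CharZero R] {F : Polynomial R} (hF : Squarefree F) (he : 2 ≤ F.natDegree) :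
    rootTest F.natDegree F ≠ 0 := by
  intro h
  set e := F.natDegree with hedef
  have ha : F.coeff e ≠ 0 := by
    have : F ≠ 0 := by
      rintro rfl
      simp [hedef] at he
    simpa [hedef] using this
  have he0 : (e : R) ≠ 0 := by
    have : e ≠ 0 := by omega
    exact_mod_cast this
  rw [rootTest, sub_eq_zero] at h
  obtain ⟨p, hp, hpG, hpd⟩ := exists_prime_dvd_of_natDegree_ne_zero
    (Polynomial.C ((e : R) * F.coeff e) * Polynomial.X + Polynomial.C (F.coeff (e - 1)))
    (by rw [Polynomial.natDegree_linear (mul_ne_zero he0 ha)]; exact one_ne_zero)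
  have hdvd := pow_dvd_pow_of_dvd hpG e
  rw [← h] at hdvd
  have hc : ¬ p ∣ Polynomial.C ((e : R) ^ e * F.coeff e ^ (e - 1)) := by
    intro hc
    have := Polynomial.natDegree_le_of_dvd hc
      (Polynomial.C_ne_zero.mpr (mul_ne_zero (pow_ne_zero _ he0) (pow_ne_zero _ ha)))
    rw [Polynomial.natDegree_C] at this
    omega
  have h2 : p * p ∣ F := by
    rw [← sq]
    exact (pow_dvd_pow p he).trans (hp.pow_dvd_of_dvd_mul_left e hc hdvd)
  exact hp.not_isUnit (hF p h2)

theorem rootTest_ne_zero_iff {Q : Polynomial ℂ} (he : Q.natDegree ≠ 0) :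
    rootTest Q.natDegree Q ≠ 0 ↔ ∃ s t : ℂ, s ≠ t ∧ Q.eval s = 0 ∧ Q.eval t = 0 := by
  set e := Q.natDegree with hedef
  have hQ : Q ≠ 0 := by
    rintro rfl
    simp [hedef] at he
  have ha : Q.coeff e ≠ 0 := by simpa [hedef] using hQ
  have he0 : (e : ℂ) ≠ 0 := by exact_mod_cast he
  constructor
  · contrapose!
    intro h
    obtain ⟨b, hb⟩ := IsAlgClosed.exists_root Q 
      fun h0 => he (Polynomial.natDegree_eq_of_degree_eq_some h0)
    have hroots : Q.roots = Multiset.replicate e b := by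
      rw [Multiset.eq_replicate]
      refine ⟨((IsAlgClosed.splits Q).natDegree_eq_card_roots).symm, fun x hx => ?_⟩
      by_contra hne
      exact h x b hne (Polynomial.isRoot_of_mem_roots hx) hb
    have hprod := (IsAlgClosed.splits Q).eq_prod_roots
    rw [hroots, Multiset.map_replicate, Multiset.prod_replicate] at hprod
    set a := Q.leadingCoeff with hadef
    have hae : Q.coeff e = a := rfl
    -- With a single root `b`, `Q = a (X - b) ^ e`, and both terms of the test equal `(e a) ^ e (X -
    -- b) ^ e`.
    have hb1 : Q.coeff (e - 1) = -(e * a * b) := by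
      obtain ⟨k, hk⟩ := Nat.exists_eq_succ_of_ne_zero he
      rw [hprod, hk, sub_eq_add_neg, ← Polynomial.C_neg, Polynomial.coeff_C_mul,
        Polynomial.coeff_X_add_C_pow]
      simp
      ring
    rw [rootTest, sub_eq_zero, hae, hb1]
    have hlin : Polynomial.C ((e : ℂ) * a) * Polynomial.X + Polynomial.C (-(e * a * b)) =
        Polynomial.C (e * a) * (Polynomial.X - Polynomial.C b) := by
      simp
      ring
    rw [hlin, mul_pow]
    conv_lhs => rw [hprod]
    rw [← mul_assoc, ← Polynomial.C_mul, ← Polynomial.C_pow, mul_assoc, pow_sub_one_mul he, mul_pow]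
  · rintro ⟨s, t, hst, hs, ht⟩ h
    rw [rootTest, sub_eq_zero] at h
    -- If the test vanishes, every root of `Q` is a root of one and the same linear polynomial.
    have key : ∀ x, Q.eval x = 0 → (e : ℂ) * Q.coeff e * x + Q.coeff (e - 1) = 0 := by
      intro x hx
      have := congrArg (Polynomial.eval x) h
      simp only [Polynomial.eval_mul, hx, mul_zero, Polynomial.eval_pow, Polynomial.eval_add,
        Polynomial.eval_C, Polynomial.eval_X] at this
      exact pow_eq_zero_iff he |>.mp this.symm
    have := (key s hs).trans (key t ht).symm
    exact hst (mul_left_cancel₀ (mul_ne_zero he0 ha) (add_right_cancel this))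

end RootTest

/-! ### Good directions -/

section Generic

variable {n : ℕ}

/-- Write `y = (y - l z) + l z`, so that `f = ∑ cᵢ(y - l z) lⁱ` with `cᵢ` homogeneous of degree `d -
i`. Only `i ≤ 1` occurs, and each `cᵢ(y - l z)` lies in `I ^ (d - i)`. -/
theorem mem_pow_of_natDegree_lineFamily_le_one {z : Fin n → ℂ} {f : MvPolynomial (Fin n) ℂ}
    {d : ℕ} (hf : f.IsHomogeneous d) (hd : 1 ≤ d) (hdeg : (lineFamily z f).natDegree ≤ 1)
    {I : Ideal (MvPolynomial (Fin n) ℂ)} {l : MvPolynomial (Fin n) ℂ}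
    (hI : ∀ i, X i - C (z i) * l ∈ I) : f ∈ I ^ (d - 1) := by
  have h := aeval_lineFamily z f (fun i => X i - C (z i) * l) l
  have hid : (fun i => X i - C (z i) * l + algebraMap ℂ _ (z i) * l) =
      (X : Fin n → MvPolynomial (Fin n) ℂ) := by
    ext1 i
    simp [algebraMap_eq]
  rw [hid, aeval_X_left_apply, Polynomial.eq_X_add_C_of_natDegree_le_one hdeg] at h
  rw [← h]
  simp only [Polynomial.eval₂_add, Polynomial.eval₂_mul, Polynomial.eval₂_C, Polynomial.eval₂_X]
  refine add_mem (Ideal.mul_mem_right _ _ ?_) ?_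
  · exact aeval_mem_pow_of_isHomogeneous (isHomogeneous_coeff_lineFamily z hf (by omega)) hI
  · exact Ideal.pow_le_pow_right (Nat.sub_le d 1)
      (aeval_mem_pow_of_isHomogeneous (isHomogeneous_coeff_lineFamily z hf (by omega)) hI)

/-- The restriction of `f` to the line through `v` in direction `z` has the generic degree, and it
has two distinct roots. -/
def IsGoodDirection (z : Fin n → ℂ) (f : MvPolynomial (Fin n) ℂ) (v : Fin n → ℂ) : Prop :=
  (lineRestriction z f v).natDegree = (lineFamily z f).natDegree ∧
    ∃ s t : ℂ, s ≠ t ∧ eval (v + s • z) f = 0 ∧ eval (v + t • z) f = 0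

/-- This form makes goodness an open condition on `v`. `rootTest` commutes with specialisation at
`v` for a fixed exponent, and that exponent is the degree of the restriction once the leading
coefficient survives. -/
theorem isGoodDirection_iff {z : Fin n → ℂ} {f : MvPolynomial (Fin n) ℂ}
    (he : (lineFamily z f).natDegree ≠ 0) (v : Fin n → ℂ) :
    IsGoodDirection z f v ↔ ∃ j, eval v ((lineFamily z f).leadingCoeff *
      (rootTest (lineFamily z f).natDegree (lineFamily z f)).coeff j) ≠ 0 := by
  have hdeg : (lineRestriction z f v).natDegree = (lineFamily z f).natDegree ↔
      eval v (lineFamily z f).leadingCoeff ≠ 0 := by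
    constructor
    · intro h h0
      have : (lineRestriction z f v).leadingCoeff = 0 := by
        rw [Polynomial.leadingCoeff, h, lineRestriction, Polynomial.coeff_map]
        exact h0
      rw [Polynomial.leadingCoeff_eq_zero] at this
      rw [this, Polynomial.natDegree_zero] at h
      exact he h.symm
    · exact Polynomial.natDegree_map_of_leadingCoeff_ne_zero _
  simp only [map_mul, ne_eq, mul_eq_zero, not_or, exists_and_left]
  rw [IsGoodDirection, hdeg]
  refine and_congr_right fun h => ?_
  have h1 := hdeg.mpr h
  simp_rw [← eval_lineRestriction]
  rw [← rootTest_ne_zero_iff (by rwa [h1]), h1, lineRestriction, ← map_rootTest, ne_eq,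
    Polynomial.ext_iff]
  simp

/-- The new vector spans the same line with `z`; the parameter changes by an affine substitution. So
goodness depends on the line only. -/
theorem IsGoodDirection.smul_add_smul {z : Fin n → ℂ} {f : MvPolynomial (Fin n) ℂ} {d : ℕ}
    (hf : f.IsHomogeneous d) {v : Fin n → ℂ} (h : IsGoodDirection z f v) {a : ℂ} (ha : a ≠ 0)
    (c : ℂ) : IsGoodDirection z f (a • v + c • z) := by
  have hline : ∀ s : ℂ, a • v + c • z + s • z = a • (v + (a⁻¹ * (s + c)) • z) := by
    intro s
    rw [smul_add, smul_smul, mul_inv_cancel_left₀ ha, add_smul]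
    abel
  obtain ⟨hd, s, t, hst, hs, ht⟩ := h
  refine ⟨?_, a * s - c, a * t - c, ?_, ?_, ?_⟩
  · have : lineRestriction z f (a • v + c • z) = Polynomial.C (a ^ d) *
        (lineRestriction z f v).comp
          (Polynomial.C a⁻¹ * Polynomial.X + Polynomial.C (a⁻¹ * c)) := by
      refine Polynomial.funext fun s => ?_
      rw [eval_lineRestriction, hline, eval_smul_of_isHomogeneous hf, ← eval_lineRestriction]
      simp [mul_add]
    rw [this, Polynomial.natDegree_C_mul (pow_ne_zero d ha), Polynomial.natDegree_comp,
      Polynomial.natDegree_linear (inv_ne_zero ha), mul_one, hd]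
  · intro h
    exact hst (mul_left_cancel₀ ha (sub_left_injective h))
  · rw [hline, sub_add_cancel, inv_mul_cancel_left₀ ha, eval_smul_of_isHomogeneous hf, hs, mul_zero]
  · rw [hline, sub_add_cancel, inv_mul_cancel_left₀ ha, eval_smul_of_isHomogeneous hf, ht, mul_zero]

theorem exists_isGoodDirection {z : Fin n → ℂ} {f : MvPolynomial (Fin n) ℂ} (hf : Squarefree f)
    (h0 : f ≠ 0) (he : 2 ≤ (lineFamily z f).natDegree) : ∃ v, IsGoodDirection z f v := by
  have hH := rootTest_ne_zero (squarefree_lineFamily z h0 hf) he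
  obtain ⟨j, hj⟩ : ∃ j, (rootTest (lineFamily z f).natDegree (lineFamily z f)).coeff j ≠ 0 := by
    by_contra! h
    exact hH (Polynomial.ext h)
  have ha := Polynomial.leadingCoeff_ne_zero.mpr (lineFamily_ne_zero z h0)
  obtain ⟨v, hv⟩ : ∃ v, eval v ((lineFamily z f).leadingCoeff *
      (rootTest (lineFamily z f).natDegree (lineFamily z f)).coeff j) ≠ 0 := by
    by_contra! h
    exact mul_ne_zero ha hj (MvPolynomial.funext fun v => by rw [h v, map_zero])
  exact ⟨v, (isGoodDirection_iff (by omega) v).mpr ⟨j, hv⟩⟩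

/-- For `v = c z` the restriction is `(c + s) ^ d f(z)`. Two distinct roots force `f(z) = 0`, so it
vanishes identically and its degree is not `e`. -/
theorem IsGoodDirection.notMem_span {z : Fin n → ℂ} {f : MvPolynomial (Fin n) ℂ} {d : ℕ}
    (hf : f.IsHomogeneous d) (he : (lineFamily z f).natDegree ≠ 0) {v : Fin n → ℂ}
    (h : IsGoodDirection z f v) : v ∉ Submodule.span ℂ {z} := by
  intro hv
  obtain ⟨c, rfl⟩ := Submodule.mem_span_singleton.mp hv
  obtain ⟨hd, s, t, hst, hs, ht⟩ := h
  rw [← add_smul, eval_smul_of_isHomogeneous hf] at hs ht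
  have hz : eval z f = 0 := by
    by_contra hz
    have hs' := eq_zero_of_pow_eq_zero ((mul_eq_zero.mp hs).resolve_right hz)
    have ht' := eq_zero_of_pow_eq_zero ((mul_eq_zero.mp ht).resolve_right hz)
    exact hst (add_left_cancel (hs'.trans ht'.symm))
  have : lineRestriction z f (c • z) = 0 := by
    refine Polynomial.funext fun s => ?_
    rw [eval_lineRestriction, ← add_smul, eval_smul_of_isHomogeneous hf, hz]
    simp
  rw [this, Polynomial.natDegree_zero] at hd
  exact he hd.symm

end Generic

/-! ### Equations, degree and multiplicity of a closed set -/

section Equations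

variable {N : ℕ} {S : Set (PN N)} {f : Coord N}

theorem mem_homogIdeal_iff {g : Coord N} :
    g ∈ homogIdeal S ↔ ∀ v ∈ affineCone S, eval v g = 0 := by
  simp_rw [homogIdeal, mem_vanishingIdeal_iff, ← coe_aeval_eq_eval]
  rfl

theorem smul_mem_affineCone {v : Fin (N + 1) → ℂ} (hv : v ∈ affineCone S) (a : ℂ) :
    a • v ∈ affineCone S := by
  obtain ⟨p, hp, hvp⟩ := hv
  exact ⟨p, hp, p.submodule.smul_mem a hvp⟩

theorem rep_mem_affineCone {p : PN N} (hp : p ∈ S) : p.rep ∈ affineCone S :=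
  ⟨p, hp, by rw [p.submodule_eq]; exact Submodule.mem_span_singleton_self _⟩

theorem homogeneousComponent_mem_homogIdeal {g : Coord N} (hg : g ∈ homogIdeal S) (k : ℕ) :
    homogeneousComponent k g ∈ homogIdeal S := by
  rw [mem_homogIdeal_iff] at hg ⊢
  exact fun v hv => eval_homogeneousComponent_eq_zero (fun a _ => hg _ (smul_mem_affineCone hv a)) k

/-- The top component of `f` lies in the ideal, so it is a multiple of `f` of the same degree, and
the cofactor is a constant. -/
theorem IsEquation.isHomogeneous (hf : IsEquation S f) (h0 : f ≠ 0) :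
    f.IsHomogeneous f.totalDegree := by
  have hmem : f ∈ homogIdeal S := by
    rw [hf]
    exact Ideal.mem_span_singleton_self f
  have htop := homogeneousComponent_mem_homogIdeal hmem f.totalDegree
  rw [hf, Ideal.mem_span_singleton] at htop
  obtain ⟨c, hc⟩ := htop
  have hne : homogeneousComponent f.totalDegree f ≠ 0 := by
    obtain ⟨x, hx, hxd⟩ := Finset.exists_mem_eq_sup f.support (support_nonempty.mpr h0)
      fun s => s.sum fun _ e => e
    intro h
    have := congrArg (coeff x) h
    rw [coeff_homogeneousComponent, if_pos, coeff_zero] at this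
    · exact mem_support_iff.mp hx this
    · rw [totalDegree, hxd]
      rfl
  have hc0 : c ≠ 0 := by
    rintro rfl
    exact hne (by rw [hc, mul_zero])
  have hhom := homogeneousComponent_isHomogeneous f.totalDegree f
  have hcd : c.totalDegree = 0 := by
    have h1 := hhom.totalDegree hne
    rw [hc, totalDegree_mul_of_isDomain h0 hc0] at h1
    omega
  rw [totalDegree_eq_zero_iff_eq_C] at hcd
  rw [hc, hcd] at hhom
  have ha : coeff 0 c ≠ 0 := by
    intro h
    rw [h, C_0] at hcd
    exact hc0 hcd
  have := hhom.mul (isHomogeneous_C (Fin (N + 1)) (coeff 0 c)⁻¹)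
  rwa [mul_assoc, ← C_mul, mul_inv_cancel₀ ha, C_1, mul_one, add_zero] at this

/-- If `f = p²c`, then `pc` vanishes wherever `f` does, so `f` divides `pc` and `p` is a unit. -/
theorem IsEquation.squarefree (hf : IsEquation S f) (h0 : f ≠ 0) : Squarefree f := by
  rintro p ⟨c, hc⟩
  have hmem : f ∈ homogIdeal S := by
    rw [hf]
    exact Ideal.mem_span_singleton_self f
  have hpc : p * c ∈ homogIdeal S := by
    rw [mem_homogIdeal_iff] at hmem ⊢
    intro v hv
    have := hmem v hv
    rw [hc, mul_assoc, map_mul] at this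
    rcases mul_eq_zero.mp this with h | h
    · rw [map_mul, h, zero_mul]
    · exact h
  rw [hf, Ideal.mem_span_singleton] at hpc
  obtain ⟨q, hq⟩ := hpc
  have hpc0 : p * c ≠ 0 := by
    intro h
    exact h0 (by rw [hc, mul_assoc, h, mul_zero])
  refine IsUnit.of_mul_eq_one q (mul_left_cancel₀ hpc0 ?_)
  rw [mul_one]
  conv_rhs => rw [hq, hc]
  ring

theorem IsEquation.mem_iff (hf : IsEquation S f) (hS : IsClosed S) (p : PN N) :
    p ∈ S ↔ eval p.rep f = 0 := by
  constructor
  · intro hp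
    have hmem : f ∈ homogIdeal S := by
      rw [hf]
      exact Ideal.mem_span_singleton_self f
    exact mem_homogIdeal_iff.mp hmem _ (rep_mem_affineCone hp)
  · intro hp
    obtain ⟨F, hF, rfl⟩ := (isClosed_iff S).mp hS
    intro g hg
    have hmem : g ∈ homogIdeal (projZeros F) := by
      rw [mem_homogIdeal_iff]
      rintro v ⟨q, hq, hv⟩
      rw [q.submodule_eq] at hv
      obtain ⟨a, rfl⟩ := Submodule.mem_span_singleton.mp hv
      obtain ⟨d, hd⟩ := hF g hg
      rw [eval_smul_of_isHomogeneous hd, hq g hg, mul_zero]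
    rw [hf, Ideal.mem_span_singleton] at hmem
    obtain ⟨c, rfl⟩ := hmem
    rw [map_mul, hp, zero_mul]

/-- `sInf ∅ = 0`, so a nonzero degree is attained by an equation. -/
theorem exists_isEquation_of_hypersurfaceDegree_ne_zero (h : hypersurfaceDegree S ≠ 0) :
    ∃ f, IsEquation S f ∧ f.totalDegree = hypersurfaceDegree S := by
  refine Nat.sInf_mem (s := {d | ∃ f, IsEquation S f ∧ f.totalDegree = d}) ?_
  by_contra hne
  rw [Set.not_nonempty_iff_eq_empty] at hne
  exact h (by rw [hypersurfaceDegree, hne, Nat.sInf_empty])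

theorem IsEquation.le_hypersurfaceMult (hf : IsEquation S f) (h0 : f ≠ 0) {p : PN N} {k : ℕ}
    (hk : f ∈ homogIdeal {p} ^ k) : k ≤ hypersurfaceMult S p := by
  refine le_csSup ⟨f.totalDegree, ?_⟩ ⟨f, hf, hk⟩
  rintro m ⟨g, hg, hm⟩
  -- The multiplicity ranges over all generators; they divide one another, so one degree bounds all
  -- exponents.
  have hfg : g ∣ f := by
    rw [← Ideal.span_singleton_le_span_singleton, ← hf, ← hg]
  refine le_totalDegree_of_mem_pow h0 (fun q hq => ?_) (Ideal.mem_of_dvd _ hfg hm)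
  exact mem_homogIdeal_iff.mp hq 0 ⟨p, rfl, p.submodule.zero_mem⟩

/-- There is a linear form `l` for which the projection `y ↦ y - l(y) p` kills `p`. -/
theorem exists_linear_sub_mem_homogIdeal (p : PN N) :
    ∃ l : Coord N, ∀ i, X i - C (p.rep i) * l ∈ homogIdeal {p} := by
  obtain ⟨j, hj⟩ := Function.ne_iff.mp p.rep_nonzero
  refine ⟨C (p.rep j)⁻¹ * X j, fun i => mem_homogIdeal_iff.mpr ?_⟩
  rintro v ⟨q, rfl, hv⟩
  rw [q.submodule_eq] at hv
  obtain ⟨a, rfl⟩ := Submodule.mem_span_singleton.mp hv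
  rw [Pi.zero_apply] at hj
  simp only [map_sub, map_mul, eval_X, eval_C, Pi.smul_apply, smul_eq_mul]
  field_simp
  ring

theorem two_le_natDegree_lineFamily {z : PN N} (hf : IsEquation S f)
    (hd : hypersurfaceMult S z + 2 ≤ f.totalDegree) : 2 ≤ (lineFamily z.rep f).natDegree := by
  have h0 : f ≠ 0 := by
    rintro rfl
    simp at hd
  by_contra! hlt
  obtain ⟨l, hl⟩ := exists_linear_sub_mem_homogIdeal z
  have := hf.le_hypersurfaceMult h0
    (mem_pow_of_natDegree_lineFamily_le_one (hf.isHomogeneous h0) (by omega) (by omega) hl)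
  omega

/-- A subset of projective space whose cone is cut out by arbitrary polynomials is closed. -/
theorem isClosed_of_forall_mk_mem_iff {ι : Type*} (g : ι → Coord N)
    (h : ∀ v (hv : v ≠ 0), Projectivization.mk ℂ v hv ∈ S ↔ ∀ i, eval v (g i) = 0) :
    IsClosed S := by
  rw [isClosed_iff]
  refine ⟨{q | ∃ i k, q = homogeneousComponent k (g i)}, ?_, ?_⟩
  · rintro _ ⟨i, k, rfl⟩
    exact ⟨k, homogeneousComponent_isHomogeneous k _⟩
  · ext p
    constructor
    · rintro hp _ ⟨i, k, rfl⟩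
      refine eval_homogeneousComponent_eq_zero (fun a ha => ?_) k
      refine (h _ (smul_ne_zero ha p.rep_nonzero)).mp ?_ i
      convert hp
      conv_rhs => rw [← p.mk_rep]
      rw [Projectivization.mk_eq_mk_iff']
      exact ⟨a, rfl⟩
    · intro hp
      rw [← p.mk_rep, h]
      intro i
      rw [← sum_homogeneousComponent (g i), map_sum]
      exact Finset.sum_eq_zero fun k _ => hp _ ⟨i, k, rfl⟩

end Equations

/-! ### Lines through `z`, with affine parameter `s ↦ [v + s z]` and `z` at infinity -/

section Lines

variable {N : ℕ}

theorem add_smul_ne_zero {v z : Fin (N + 1) → ℂ} (h : v ∉ Submodule.span ℂ {z}) (s : ℂ) :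
    v + s • z ≠ 0 := by
  intro h0
  exact h (Submodule.mem_span_singleton.mpr
    ⟨-s, by rw [neg_smul, eq_neg_of_add_eq_zero_left h0]⟩)

theorem mk_mem_lineThrough (z : PN N) {v : Fin (N + 1) → ℂ} (hv : v ≠ 0) (s : ℂ)
    (hs : v + s • z.rep ≠ 0) :
    Projectivization.mk ℂ _ hs ∈ lineThrough z (Projectivization.mk ℂ v hv) := by
  change Projectivization.submodule _ ≤ _
  rw [Projectivization.submodule_mk, Submodule.span_singleton_le_iff_mem,
    Projectivization.submodule_mk, z.submodule_eq, add_comm v]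
  exact Submodule.add_mem_sup (Submodule.smul_mem _ _ (Submodule.mem_span_singleton_self _))
    (Submodule.mem_span_singleton_self _)

theorem mk_add_smul_ne {z : PN N} {v : Fin (N + 1) → ℂ} (h : v ∉ Submodule.span ℂ {z.rep})
    (s : ℂ) :
    Projectivization.mk ℂ _ (add_smul_ne_zero h s) ≠ z := by
  intro heq
  have hmem : v + s • z.rep ∈
      (Projectivization.mk ℂ _ (add_smul_ne_zero h s)).submodule := by
    rw [Projectivization.submodule_mk]
    exact Submodule.mem_span_singleton_self _
  rw [heq, z.submodule_eq] at hmem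
  refine h ?_
  simpa using sub_mem hmem
    (Submodule.smul_mem _ s (Submodule.mem_span_singleton_self (R := ℂ) z.rep))

theorem mk_add_smul_injective {z : PN N} {v : Fin (N + 1) → ℂ}
    (h : v ∉ Submodule.span ℂ {z.rep}) :
    Function.Injective fun s => Projectivization.mk ℂ _ (add_smul_ne_zero h s) := by
  intro s t hst
  obtain ⟨a, ha⟩ := (Projectivization.mk_eq_mk_iff' ..).mp hst
  have ha1 : (a - 1) • v = (s - a * t) • z.rep := by
    rw [sub_smul, sub_smul, mul_smul, one_smul, sub_eq_sub_iff_add_eq_add, ← smul_add, ha]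
    abel
  have ha' : a = 1 := by
    by_contra hne
    refine h (Submodule.mem_span_singleton.mpr ⟨(a - 1)⁻¹ * (s - a * t), ?_⟩)
    rw [mul_smul, ← ha1, smul_smul, inv_mul_cancel₀ (sub_ne_zero.mpr hne), one_smul]
  rw [ha', sub_self, zero_smul, one_mul, eq_comm, smul_eq_zero] at ha1
  exact sub_eq_zero.mp (ha1.resolve_right z.rep_nonzero)

theorem isLine_lineThrough {z q : PN N} (h : q ≠ z) : IsLine (lineThrough z q) := by
  refine ⟨z.submodule ⊔ q.submodule, ?_, rfl⟩
  have hli := Projectivization.linearIndependent_pair_iff_ne.mpr h.symm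
  have hrange := Matrix.range_cons_cons_empty z.rep q.rep ![]
  rw [z.submodule_eq, q.submodule_eq, ← Submodule.span_union, Set.singleton_union, ← hrange]
  exact finrank_span_eq_card hli

/-- Puts two points of one line through `z` in the form needed by `IsGoodDirection.smul_add_smul`.
-/
theorem exists_smul_add_smul_of_lineThrough_eq {z q q' : PN N} (hq : q ≠ z)
    (h : lineThrough z q = lineThrough z q') :
    ∃ a c : ℂ, a ≠ 0 ∧ q.rep = a • q'.rep + c • z.rep := by
  have hmem : q ∈ lineThrough z q' := by
    rw [← h]
    exact le_sup_right (α := Submodule ℂ (Fin (N + 1) → ℂ))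
  change q.submodule ≤ _ at hmem
  rw [q.submodule_eq, Submodule.span_singleton_le_iff_mem, z.submodule_eq, q'.submodule_eq,
    Submodule.mem_sup] at hmem
  obtain ⟨_, h1, _, h2, h3⟩ := hmem
  obtain ⟨c, rfl⟩ := Submodule.mem_span_singleton.mp h1
  obtain ⟨a, rfl⟩ := Submodule.mem_span_singleton.mp h2
  refine ⟨a, c, ?_, by rw [← h3, add_comm (c • _)]⟩
  rintro rfl
  refine hq ?_
  rw [← q.mk_rep, ← z.mk_rep, Projectivization.mk_eq_mk_iff']
  exact ⟨c, by rw [← h3, zero_smul, add_zero]⟩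

end Lines

/-! ### The generic line through `z` -/

/-- If the restriction of the equation of a closed set to the generic line through `z` has degree
at least two, the generic line through `z` meets that set in two distinct points other than `z`,
and is not contained in it. -/
theorem IsEquation.genericLineThrough {N : ℕ} {S : Set (PN N)} {f : Coord N} {z : PN N}
    (hf : IsEquation S f) (h0 : f ≠ 0) (hS : IsClosed S)
    (he : 2 ≤ (lineFamily z.rep f).natDegree) :
    GenericLineThrough z fun L => IsLine L ∧ z ∈ L ∧
      (∃ q₀ ∈ L ∩ S, ∃ q₁ ∈ L ∩ S, q₀ ≠ q₁ ∧ q₀ ≠ z ∧ q₁ ≠ z) ∧ ¬ L ⊆ S := by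
  have hom := hf.isHomogeneous h0
  have hspan : ∀ v, IsGoodDirection z.rep f v → v ∉ Submodule.span ℂ {z.rep} :=
    fun v hv => hv.notMem_span hom (by omega)
  have hgood_ne : ∀ q : PN N, IsGoodDirection z.rep f q.rep → q ≠ z := by
    rintro q hq rfl
    exact hspan _ hq (Submodule.mem_span_singleton_self _)
  have hmk : ∀ v (hv : v ≠ 0), IsGoodDirection z.rep f (Projectivization.mk ℂ v hv).rep ↔
      IsGoodDirection z.rep f v := by
    intro v hv
    obtain ⟨a, ha⟩ := Projectivization.exists_smul_eq_mk_rep ℂ v hv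
    rw [← ha, Units.smul_def]
    constructor
    · intro h
      simpa [smul_smul] using h.smul_add_smul hom (inv_ne_zero a.ne_zero) 0
    · intro h
      simpa using h.smul_add_smul hom a.ne_zero 0
  have hmem : ∀ v (hv : v ≠ 0), Projectivization.mk ℂ v hv ∈ S ↔ eval v f = 0 :=
    fun v hv => (hf.mem_iff hS _).trans (eval_rep_eq_zero_iff hom v hv)
  refine ⟨{L | ∃ q : PN N, L = lineThrough z q ∧ IsGoodDirection z.rep f q.rep}, ?_, ?_, ?_, ?_⟩
  · rintro _ ⟨q, rfl, hq⟩
    exact ⟨isLine_lineThrough (hgood_ne q hq), le_sup_left (α := Submodule ℂ (Fin (N + 1) → ℂ))⟩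
  · obtain ⟨v, hv⟩ := exists_isGoodDirection (hf.squarefree h0) h0 he
    have hv0 : v ≠ 0 := by
      rintro rfl
      exact hspan _ hv (Submodule.zero_mem _)
    exact ⟨_, Projectivization.mk ℂ v hv0, rfl, (hmk v hv0).mpr hv⟩
  -- Goodness is independent of the point chosen on the line, so the preimage of `U` under
  -- projection from `z` is exactly the set of good `q`.
  · have hset : {q : PN N | q ≠ z ∧ lineThrough z q ∈
        {L | ∃ q : PN N, L = lineThrough z q ∧ IsGoodDirection z.rep f q.rep}} =
        {q | ¬ IsGoodDirection z.rep f q.rep}ᶜ := by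
      ext q
      rw [Set.mem_compl_iff, Set.mem_ofPred_eq, Set.mem_ofPred_eq, Set.mem_ofPred_eq, not_not]
      constructor
      · rintro ⟨hqz, q', hqq', hq'⟩
        obtain ⟨a, c, ha, hq⟩ := exists_smul_add_smul_of_lineThrough_eq hqz hqq'
        rw [hq]
        exact hq'.smul_add_smul hom ha c
      · exact fun hq => ⟨hgood_ne q hq, q, rfl, hq⟩
    rw [hset, isOpen_compl_iff]
    refine isClosed_of_forall_mk_mem_iff (fun j => (lineFamily z.rep f).leadingCoeff *
      (rootTest (lineFamily z.rep f).natDegree (lineFamily z.rep f)).coeff j) fun v hv => ?_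
    rw [Set.mem_ofPred_eq, hmk, isGoodDirection_iff (by omega)]
    push Not
    rfl
  · rintro _ ⟨q, rfl, hq⟩
    have hqs := hspan _ hq
    have hline : ∀ s : ℂ, Projectivization.mk ℂ _ (add_smul_ne_zero hqs s) ∈ lineThrough z q := by
      intro s
      simpa only [q.mk_rep] using mk_mem_lineThrough z q.rep_nonzero s (add_smul_ne_zero hqs s)
    refine ⟨isLine_lineThrough (hgood_ne q hq),
      le_sup_left (α := Submodule ℂ (Fin (N + 1) → ℂ)), ?_, ?_⟩
    · obtain ⟨-, s, t, hst, hs, ht⟩ := hq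
      exact ⟨_, ⟨hline s, (hmem _ _).mpr hs⟩, _, ⟨hline t, (hmem _ _).mpr ht⟩,
        (mk_add_smul_injective hqs).ne hst, mk_add_smul_ne hqs s, mk_add_smul_ne hqs t⟩
    · intro hsub
      -- A line inside `S` would have zero restriction, whereas a good direction has one of degree
      -- at least 2.
      have hzero : lineRestriction z.rep f q.rep = 0 := by
        refine Polynomial.funext fun s => ?_
        rw [eval_lineRestriction, Polynomial.eval_zero]
        exact (hmem _ _).mp (hsub (hline s))
      have := hq.1
      rw [hzero, Polynomial.natDegree_zero] at this
      omega

end SecantDrop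

theorem mainTheorem6 (N r : ℕ) (hr : 1 ≤ r) (X : Set (SecantDrop.PN N))
    (hX : SecantDrop.IsIrreducibleVariety X)
    (hS : SecantDrop.IsHypersurface (SecantDrop.secantVariety X r))
    (z : SecantDrop.PN N) (hz : z ∈ X)
    (hmult : SecantDrop.hypersurfaceMult (SecantDrop.secantVariety X r) z + 2 ≤
      SecantDrop.hypersurfaceDegree (SecantDrop.secantVariety X r)) :
    SecantDrop.GenericLineThrough z (fun L => SecantDrop.IsDoubleDropSecant X r z L) := by
  obtain ⟨f, hf, hd⟩ := SecantDrop.exists_isEquation_of_hypersurfaceDegree_ne_zero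
    (S := SecantDrop.secantVariety X r) (by omega)
  have h0 : f ≠ 0 := by
    rintro rfl
    rw [MvPolynomial.totalDegree_zero] at hd
    omega
  obtain ⟨U, hU, hne, hopen, h⟩ := hf.genericLineThrough h0 hS.1
    (SecantDrop.two_le_natDegree_lineFamily (z := z) hf (by omega))
  refine ⟨U, hU, hne, hopen, fun L hL => ?_⟩
  obtain ⟨hline, hzL, hpts, hsub⟩ := h L hL
  exact ⟨hline, ⟨hzL, hz⟩, hpts, hsub⟩
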